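/- **Continuity of the nested Average Value-at-Risk.** Let $T\in\mathbb N$, let $\Xi_1,\dots,\Xi_T$ be nonempty Polish spaces, and let $\Xi=\Xi_1\times\dots\times\Xi_T$ carry a metric $d$ that induces the product topology. Write $x_{1:t}=(x_1,\dots,x_t)$, with $x_{1:0}=()$ the empty tuple. For a Borel probability measure $P$ on $\Xi$ let $P_t(\cdot\mid x_{1:t-1})$ denote the regular conditional distribution under $P$ of the $t$-th coordinate given the first $t-1$ coordinates. *Nested Average Value-at-Risk.* For a probability measure $\mu$ and $\alpha\in[0,1)$ put $$\mathrm{AVaR}_{\alpha;\mu}(Y)=\inf_{q\in\mathbb R}\Bigl\{q+\tfrac1{1-\alpha}\,\mathbb E_\mu (Y-q)_+\Bigr\},$$ and $\mathrm{AVaR}_{1;\mu}(Y)=\operatorname{ess\,sup}_\mu Y$. For $\alpha_1,\dots,\alpha_T\in[0,1]$ and $Y\in L^1(P)$ set $Y_T=Y$ and, for $t=T,\dots,1$, $$Y_{t-1}(x_{1:t-1})=\mathrm{AVaR}_{\alpha_t;\,P_t(\cdot\mid x_{1:t-1})}\bigl(\xi\mapsto Y_t(x_{1:t-1},\xi)\bigr),\qquad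 \mathrm{nAVaR}_{\alpha_{1:T};P}(Y):=Y_0 .$$ *Nested distance.* Let $r\in[1,\infty)$. For a cost function $c\ge 0$ let $w_r(\mu,\nu;c)=\inf_\pi\bigl(\int c^r\,\mathrm d\pi\bigr)^{1/r}\in[0,\infty]$, the infimum being over all probability measures $\pi$ with marginals $\mu$ and $\nu$. For Borel probability measures $P,\tilde P$ on $\Xi$ set $c_T=d$ and, for $t=T,\dots,1$, $$c_{t-1}(x_{1:t-1},y_{1:t-1})=w_r\Bigl(P_t(\cdot\mid x_{1:t-1}),\tilde P_t(\cdot\mid y_{1:t-1});\ (\xi,\eta)\mapsto c_t\bigl((x_{1:t-1},\xi),(y_{1:t-1},\eta)\bigr)\Bigr),\qquad \mathrm{nd}_r(P,\tilde P):=c_0\in[0,\infty].$$ **Statement.** Let $P,\tilde P$ be Borel probability measures on $\Xi$, let $L\ge0$, and let $Y\colon\Xi\to\mathbb R$ satisfy $|Y(x)-Y(y)|\le L\,d(x,y)$ for all $x,y\in\Xi$ and be integrable with respect to both $P$ and $\tilde P$. Let $\alpha_1,\dots,\alpha_T\in[0,1]$ and let $\alpha<1$ satisfy $\alpha\ge 1-\prod_{t=1}^T(1-\alpha_t)$.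 Then, for every $r\in[1,\infty)$, $$\bigl|\mathrm{nAVaR}_{\alpha_{1:T};P}(Y)-\mathrm{nAVaR}_{\alpha_{1:T};\tilde P}(Y)\bigr|\le\frac{L}{1-\alpha}\,\mathrm{nd}_r(P,\tilde P)$$ (with the convention $0\cdot\infty=0$ on the right). -/

import Mathlib

open MeasureTheory ProbabilityTheory
open scoped ENNReal

universe u

/-- The Average Value-at-Risk of `Y` at level `α` under the probability measure `μ`:
`inf_q (q + E (Y - q)₊ / (1 - α))` for `α < 1`, and the essential supremum (for bounded `Y`) for `α = 1`. -/
noncomputable def AVaR {X : Type*} [MeasurableSpace X] (α : ℝ) (μ : Measure X) (Y : X → ℝ) : ℝ :=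
  open Classical in
  if α = 1 then essSup Y μ
  else ⨅ q : ℝ, (q + 1 / (1 - α) * ∫ x, max (Y x - q) 0 ∂μ)

/-- The Wasserstein distance of order `r` between `μ` and `ν` for the cost function `c`:
the infimum of `(E_π c ^ r) ^ (1 / r)` over all measures `π` with marginals `μ` and `ν`. -/
noncomputable def wasserstein {X : Type*} [MeasurableSpace X] (r : ℝ) (c : X → X → ℝ≥0∞)
    (μ ν : Measure X) : ℝ≥0∞ :=
  ⨅ (π : Measure (X × X)) (_ : π.fst = μ ∧ π.snd = ν),
    (∫⁻ z, c z.1 z.2 ^ r ∂π) ^ (1 / r)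

/-- The marginal on the first `n` of `n + 1` stages. -/
noncomputable def initMarginal {n : ℕ} {Ξ : Fin (n + 1) → Type u} [∀ t, MeasurableSpace (Ξ t)]
    (P : Measure (∀ t, Ξ t)) : Measure (∀ t : Fin n, Ξ t.castSucc) :=
  P.map (fun x t => x t.castSucc)

instance initMarginal_isFiniteMeasure {n : ℕ} {Ξ : Fin (n + 1) → Type u} [∀ t, MeasurableSpace (Ξ t)]
    (P : Measure (∀ t, Ξ t)) [IsFiniteMeasure P] : IsFiniteMeasure (initMarginal P) := by
  unfold initMarginal; infer_instance

/-- The regular conditional distribution of the last stage given the history of all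
previous stages. -/
noncomputable def lastKernel {n : ℕ} {Ξ : Fin (n + 1) → Type u} [∀ t, MeasurableSpace (Ξ t)]
    [∀ t, StandardBorelSpace (Ξ t)] [∀ t, Nonempty (Ξ t)]
    (P : Measure (∀ t, Ξ t)) [IsFiniteMeasure P] :
    Kernel (∀ t : Fin n, Ξ t.castSucc) (Ξ (Fin.last n)) :=
  condDistrib (fun x : ∀ t, Ξ t => x (Fin.last n)) (fun x (t : Fin n) => x t.castSucc) P

/-- The nested Average Value-at-Risk: the innermost `AVaR` is taken with respect to the
conditional distribution of the last stage given the history; what results is a random variable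
on the previous stages, to which the construction is applied again. With no stage left it is a
number, the value at the empty tuple. -/
noncomputable def nestedAVaR : {T : ℕ} → {Ξ : Fin T → Type u} → [∀ t, MeasurableSpace (Ξ t)] →
    [∀ t, StandardBorelSpace (Ξ t)] → [∀ t, Nonempty (Ξ t)] →
    (α : Fin T → ℝ) → (P : Measure (∀ t, Ξ t)) → [IsFiniteMeasure P] →
    (Y : (∀ t, Ξ t) → ℝ) → ℝ
  | 0, _, _, _, _, _, _, _, Y => Y (fun t => t.elim0)
  | n + 1, Ξ, _, _, _, α, P, _, Y =>
    nestedAVaR (Ξ := fun t : Fin n => Ξ t.castSucc) (fun t => α t.castSucc) (initMarginal P)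
      (fun x => AVaR (α (Fin.last n)) (lastKernel P x) (fun ξ => Y (Fin.snoc (α := Ξ) x ξ)))

/-- The initial value `c₀` of the cost process of order `r` with terminal cost `c_T = c` and
`c_{t-1}(x, y) = w_r (P_t(· | x_{1:t-1}), Q_t(· | y_{1:t-1}); c_t)`. -/
noncomputable def nestedCost (r : ℝ) : {T : ℕ} → {Ξ : Fin T → Type u} →
    [∀ t, MeasurableSpace (Ξ t)] → [∀ t, StandardBorelSpace (Ξ t)] → [∀ t, Nonempty (Ξ t)] →
    (c : (∀ t, Ξ t) → (∀ t, Ξ t) → ℝ≥0∞) →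
    (P Q : Measure (∀ t, Ξ t)) → [IsFiniteMeasure P] → [IsFiniteMeasure Q] → ℝ≥0∞
  | 0, _, _, _, _, c, _, _, _, _ => c (fun t => t.elim0) (fun t => t.elim0)
  | n + 1, Ξ, _, _, _, c, P, Q, _, _ =>
    nestedCost r (Ξ := fun t : Fin n => Ξ t.castSucc)
      (fun x y => wasserstein r
        (fun ξ η => c (Fin.snoc (α := Ξ) x ξ) (Fin.snoc (α := Ξ) y η))
        (lastKernel P x) (lastKernel Q y))
      (initMarginal P) (initMarginal Q)

/-- The nested distance of order `r` with respect to the distance `d` on the path space. -/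
noncomputable def nestedDist {T : ℕ} {Ξ : Fin T → Type u} [∀ t, MeasurableSpace (Ξ t)]
    [∀ t, StandardBorelSpace (Ξ t)] [∀ t, Nonempty (Ξ t)]
    (r : ℝ) (d : (∀ t, Ξ t) → (∀ t, Ξ t) → ℝ)
    (P Q : Measure (∀ t, Ξ t)) [IsFiniteMeasure P] [IsFiniteMeasure Q] : ℝ≥0∞ :=
  nestedCost r (fun x y => ENNReal.ofReal (d x y)) P Q

/-! One stage carries the proof. For `α < 1`, AVaR depends only on the law and is `1 / (1 -
α)`-Lipschitz in `L¹`. Evaluating both AVaRs under a common coupling, bounding `L¹` by `Lʳ` and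
minimising over couplings turns `|Y - Z| ≤ K c` into the same inequality one stage earlier, with `K
/ (1 - α)` and the Wasserstein cost (`ofReal_abs_AVaR_sub_le_wasserstein`). Backward iteration
yields `L / ∏ (1 - α t) ≤ L / (1 - a)`.

The induction compares two different variables, since the conditional AVaRs under `P` and `Q`
differ. It asks for the inequality only on sets of full measure, since conditional integrability
holds only almost everywhere. The cost need not be measurable. -/

section AverageValueAtRisk

variable {X : Type*} [MeasurableSpace X] {μ : Measure X} {α : ℝ} {f g : X → ℝ}

lemma AVaR_of_lt_one (hα : α < 1) (μ : Measure X) (f : X → ℝ) :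
    AVaR α μ f = ⨅ q : ℝ, (q + 1 / (1 - α) * ∫ x, max (f x - q) 0 ∂μ) := by
  rw [AVaR, if_neg hα.ne]

lemma one_le_one_div_one_sub (hα0 : 0 ≤ α) (hα : α < 1) : 1 ≤ 1 / (1 - α) := by
  rw [le_div_iff₀ (by linarith)]
  linarith

lemma integrable_max_sub_zero [IsFiniteMeasure μ] (hf : Integrable f μ) (q : ℝ) :
    Integrable (fun x => max (f x - q) 0) μ :=
  (hf.sub (integrable_const q)).pos_part

/-- Bounding the objective below uniformly in `q` makes the real-valued infimum a genuine one. -/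
lemma integral_le_add_mul_integral_max [IsProbabilityMeasure μ] (hα0 : 0 ≤ α) (hα : α < 1)
    (hf : Integrable f μ) (q : ℝ) :
    ∫ x, f x ∂μ ≤ q + 1 / (1 - α) * ∫ x, max (f x - q) 0 ∂μ := by
  have h1 : ∫ x, (f x - q) ∂μ ≤ ∫ x, max (f x - q) 0 ∂μ :=
    integral_mono (hf.sub (integrable_const q)) (integrable_max_sub_zero hf q)
      fun x => le_max_left _ _
  have h0 : 0 ≤ ∫ x, max (f x - q) 0 ∂μ := integral_nonneg fun x => le_max_right _ _
  have h2 := mul_le_mul_of_nonneg_right (one_le_one_div_one_sub hα0 hα) h0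
  rw [integral_sub hf (integrable_const q)] at h1
  simp only [integral_const, probReal_univ, one_smul] at h1
  linarith

lemma bddBelow_AVaR [IsProbabilityMeasure μ] (hα0 : 0 ≤ α) (hα : α < 1) (hf : Integrable f μ) :
    BddBelow (Set.range fun q : ℝ => q + 1 / (1 - α) * ∫ x, max (f x - q) 0 ∂μ) := by
  refine ⟨∫ x, f x ∂μ, ?_⟩
  rintro _ ⟨q, rfl⟩
  exact integral_le_add_mul_integral_max hα0 hα hf q

lemma AVaR_le [IsProbabilityMeasure μ] (hα0 : 0 ≤ α) (hα : α < 1) (hf : Integrable f μ) (q : ℝ) :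
    AVaR α μ f ≤ q + 1 / (1 - α) * ∫ x, max (f x - q) 0 ∂μ := by
  rw [AVaR_of_lt_one hα]
  exact ciInf_le (bddBelow_AVaR hα0 hα hf) q

lemma integral_le_AVaR [IsProbabilityMeasure μ] (hα0 : 0 ≤ α) (hα : α < 1)
    (hf : Integrable f μ) : ∫ x, f x ∂μ ≤ AVaR α μ f := by
  rw [AVaR_of_lt_one hα]
  exact le_ciInf (integral_le_add_mul_integral_max hα0 hα hf)

lemma abs_AVaR_le [IsProbabilityMeasure μ] (hα0 : 0 ≤ α) (hα : α < 1) (hf : Integrable f μ) :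
    |AVaR α μ f| ≤ 1 / (1 - α) * ∫ x, |f x| ∂μ := by
  have h1 := one_le_one_div_one_sub hα0 hα
  have h0 : 0 ≤ ∫ x, |f x| ∂μ := integral_nonneg fun x => abs_nonneg _
  rw [abs_le]
  constructor
  · have h2 := integral_le_AVaR hα0 hα hf
    have h3 := neg_abs_le (∫ x, f x ∂μ)
    have h4 := abs_integral_le_integral_abs (f := f) (μ := μ)
    have h5 := mul_le_mul_of_nonneg_right h1 h0
    linarith
  · refine (AVaR_le hα0 hα hf 0).trans ?_
    rw [zero_add]
    refine mul_le_mul_of_nonneg_left ?_ (zero_le_one.trans h1)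
    refine integral_mono (integrable_max_sub_zero hf 0) hf.abs fun x => ?_
    simp [le_abs_self]

/-- Use the same `q` for both: `(f - q)₊ ≤ (g - q)₊ + |f - g|`. -/
lemma AVaR_sub_le [IsProbabilityMeasure μ] (hα0 : 0 ≤ α) (hα : α < 1) (hf : Integrable f μ)
    (hg : Integrable g μ) :
    AVaR α μ f - AVaR α μ g ≤ 1 / (1 - α) * ∫ x, |f x - g x| ∂μ := by
  have h1 := one_le_one_div_one_sub hα0 hα
  rw [sub_le_comm, AVaR_of_lt_one hα μ g]
  refine le_ciInf fun q => ?_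
  have h2 := AVaR_le hα0 hα hf q
  have h3 : ∫ x, max (f x - q) 0 ∂μ ≤ ∫ x, max (g x - q) 0 ∂μ + ∫ x, |f x - g x| ∂μ := by
    have hd : Integrable (fun x => |f x - g x|) μ := (hf.sub hg).abs
    rw [← integral_add (integrable_max_sub_zero hg q) hd]
    refine integral_mono (integrable_max_sub_zero hf q)
      ((integrable_max_sub_zero hg q).add hd) fun x => ?_
    have h5 := le_abs_self (f x - g x)
    have h6 := le_max_left (g x - q) 0
    have h7 := le_max_right (g x - q) 0
    exact max_le (by linarith) (by positivity)
  have h4 := mul_le_mul_of_nonneg_left h3 (zero_le_one.trans h1)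
  rw [mul_add] at h4
  linarith

lemma abs_AVaR_sub_le [IsProbabilityMeasure μ] (hα0 : 0 ≤ α) (hα : α < 1) (hf : Integrable f μ)
    (hg : Integrable g μ) :
    |AVaR α μ f - AVaR α μ g| ≤ 1 / (1 - α) * ∫ x, |f x - g x| ∂μ := by
  refine abs_le'.2 ⟨AVaR_sub_le hα0 hα hf hg, ?_⟩
  rw [neg_sub]
  simpa only [abs_sub_comm] using AVaR_sub_le hα0 hα hg hf

lemma AVaR_map {Z : Type*} [MeasurableSpace Z] {φ : X → Z} (hφ : Measurable φ) (hα : α < 1)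
    {h : Z → ℝ} (hh : AEStronglyMeasurable h (μ.map φ)) :
    AVaR α (μ.map φ) h = AVaR α μ (h ∘ φ) := by
  rw [AVaR_of_lt_one hα, AVaR_of_lt_one hα]
  congr! 4 with q
  exact integral_map hφ.aemeasurable
    (((hh.aemeasurable.sub_const q).max aemeasurable_const).aestronglyMeasurable)

/-- A countable infimum gives measurability of the conditional AVaR in the history. -/
lemma AVaR_eq_iInf_rat [IsProbabilityMeasure μ] (hα0 : 0 ≤ α) (hα : α < 1)
    (hf : Integrable f μ) :
    AVaR α μ f = ⨅ q : ℚ, ((q : ℝ) + 1 / (1 - α) * ∫ x, max (f x - q) 0 ∂μ) := by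
  have h1 := one_le_one_div_one_sub hα0 hα
  refine le_antisymm (le_ciInf fun q => AVaR_le hα0 hα hf q) ?_
  rw [AVaR_of_lt_one hα]
  refine le_ciInf fun q => le_of_forall_pos_le_add fun ε hε => ?_
  -- Raising `q` to a rational `p < q + ε` only shrinks the integral and costs at most `ε`.
  obtain ⟨p, hqp, hpq⟩ := exists_rat_btwn (lt_add_of_pos_right q hε)
  have hbdd : BddBelow
      (Set.range fun q : ℚ => (q : ℝ) + 1 / (1 - α) * ∫ x, max (f x - q) 0 ∂μ) :=
    ⟨∫ x, f x ∂μ, by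
      rintro _ ⟨q, rfl⟩
      exact integral_le_add_mul_integral_max hα0 hα hf q⟩
  refine (ciInf_le hbdd p).trans ?_
  have h2 : ∫ x, max (f x - p) 0 ∂μ ≤ ∫ x, max (f x - q) 0 ∂μ :=
    integral_mono (integrable_max_sub_zero hf p) (integrable_max_sub_zero hf q)
      fun x => max_le_max (by linarith) le_rfl
  have h3 := mul_le_mul_of_nonneg_left h2 (zero_le_one.trans h1)
  linarith

end AverageValueAtRisk

/-! ### One-stage comparison through couplings -/

section Wasserstein

variable {X : Type*} [MeasurableSpace X] {α r K : ℝ} {μ ν : Measure X} {f g : X → ℝ}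

lemma ofReal_abs_AVaR_sub_le_of_coupling [IsProbabilityMeasure μ]
    [IsProbabilityMeasure ν] (hα0 : 0 ≤ α) (hα : α < 1) (hr : 1 ≤ r)
    (hf : Integrable f μ) (hg : Integrable g ν) {c : X → X → ℝ≥0∞} {s t : Set X}
    (hs : s ∈ ae μ) (ht : t ∈ ae ν)
    (h : ∀ x ∈ s, ∀ y ∈ t, ENNReal.ofReal |f x - g y| ≤ ENNReal.ofReal K * c x y)
    {π : Measure (X × X)} (h₁ : π.fst = μ) (h₂ : π.snd = ν) :
    ENNReal.ofReal |AVaR α μ f - AVaR α ν g|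
      ≤ ENNReal.ofReal (K / (1 - α)) * (∫⁻ z, c z.1 z.2 ^ r ∂π) ^ (1 / r) := by
  subst h₁ h₂
  have hπ : IsProbabilityMeasure π := ⟨by
    rw [← Measure.fst_univ]; exact measure_univ⟩
  have hr0 : 0 < r := one_pos.trans_le hr
  have h1 := one_le_one_div_one_sub hα0 hα
  have hf' : Integrable (fun z : X × X => f z.1) π := hf.comp_measurable measurable_fst
  have hg' : Integrable (fun z : X × X => g z.2) π := hg.comp_measurable measurable_snd
  have hd : Integrable (fun z : X × X => f z.1 - g z.2) π := hf'.sub hg'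
  have hle : ∀ᵐ z ∂π, ENNReal.ofReal |f z.1 - g z.2| ≤ ENNReal.ofReal K * c z.1 z.2 := by
    filter_upwards [ae_of_ae_map measurable_fst.aemeasurable hs,
      ae_of_ae_map measurable_snd.aemeasurable ht] with z hz₁ hz₂ using h _ hz₁ _ hz₂
  have hmain : ∫⁻ z, ENNReal.ofReal |f z.1 - g z.2| ∂π
      ≤ ENNReal.ofReal K * (∫⁻ z, c z.1 z.2 ^ r ∂π) ^ (1 / r) := by
    calc ∫⁻ z, ENNReal.ofReal |f z.1 - g z.2| ∂π
        -- `Lᵖ` norms increase with the exponent on a probability space.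
        ≤ (∫⁻ z, ENNReal.ofReal |f z.1 - g z.2| ^ r ∂π) ^ (1 / r) := by
          simpa [eLpNorm', ← ofReal_norm] using
            eLpNorm'_le_eLpNorm'_of_exponent_le one_pos hr π hd.aestronglyMeasurable
      _ ≤ (∫⁻ z, ENNReal.ofReal K ^ r * c z.1 z.2 ^ r ∂π) ^ (1 / r) := by
          gcongr ?_ ^ (1 / r)
          refine lintegral_mono_ae (hle.mono fun z hz => ?_)
          rw [← ENNReal.mul_rpow_of_nonneg _ _ hr0.le]
          gcongr
      _ = ENNReal.ofReal K * (∫⁻ z, c z.1 z.2 ^ r ∂π) ^ (1 / r) := by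
          -- Finiteness of the constant replaces measurability of `c` here.
          rw [lintegral_const_mul' _ _ (by simp [hr0.le]),
            ENNReal.mul_rpow_of_nonneg _ _ (by positivity), ← ENNReal.rpow_mul,
            mul_one_div_cancel hr0.ne', ENNReal.rpow_one]
  have hA : |AVaR α π.fst f - AVaR α π.snd g| ≤ 1 / (1 - α) * ∫ z, |f z.1 - g z.2| ∂π := by
    rw [Measure.fst, Measure.snd, AVaR_map measurable_fst hα hf.aestronglyMeasurable,
      AVaR_map measurable_snd hα hg.aestronglyMeasurable]
    exact abs_AVaR_sub_le hα0 hα hf' hg'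
  calc ENNReal.ofReal |AVaR α π.fst f - AVaR α π.snd g|
      ≤ ENNReal.ofReal (1 / (1 - α) * ∫ z, |f z.1 - g z.2| ∂π) := ENNReal.ofReal_le_ofReal hA
    _ = ENNReal.ofReal (1 / (1 - α)) * ∫⁻ z, ENNReal.ofReal |f z.1 - g z.2| ∂π := by
        rw [ENNReal.ofReal_mul (zero_le_one.trans h1), ofReal_integral_eq_lintegral_ofReal hd.abs
          (Filter.Eventually.of_forall fun z => abs_nonneg _)]
    _ ≤ ENNReal.ofReal (1 / (1 - α))
          * (ENNReal.ofReal K * (∫⁻ z, c z.1 z.2 ^ r ∂π) ^ (1 / r)) := by gcongr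
    _ = ENNReal.ofReal (K / (1 - α)) * (∫⁻ z, c z.1 z.2 ^ r ∂π) ^ (1 / r) := by
        rw [← mul_assoc, ← ENNReal.ofReal_mul (zero_le_one.trans h1), one_div_mul_eq_div]

lemma ofReal_abs_AVaR_sub_le_wasserstein [IsProbabilityMeasure μ] [IsProbabilityMeasure ν]
    (hα0 : 0 ≤ α) (hα : α < 1) (hr : 1 ≤ r)
    (hf : Integrable f μ) (hg : Integrable g ν) {c : X → X → ℝ≥0∞} {s t : Set X}
    (hs : s ∈ ae μ) (ht : t ∈ ae ν)
    (h : ∀ x ∈ s, ∀ y ∈ t, ENNReal.ofReal |f x - g y| ≤ ENNReal.ofReal K * c x y) :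
    ENNReal.ofReal |AVaR α μ f - AVaR α ν g|
      ≤ ENNReal.ofReal (K / (1 - α)) * wasserstein r c μ ν := by
  -- An empty infimum would be `∞`, and a zero constant could not be moved inside it.
  have : Nonempty {π : Measure (X × X) // π.fst = μ ∧ π.snd = ν} :=
    ⟨⟨μ.prod ν, Measure.fst_prod, Measure.snd_prod⟩⟩
  rw [wasserstein, iInf_subtype', ENNReal.mul_iInf (fun h => absurd h ENNReal.ofReal_ne_top)]
  exact le_iInf fun π =>
    ofReal_abs_AVaR_sub_le_of_coupling hα0 hα hr hf hg hs ht h π.2.1 π.2.2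

end Wasserstein

/-! ### Splitting off the last stage -/

section Disintegration

variable {n : ℕ} {Ξ : Fin (n + 1) → Type u} [∀ t, MeasurableSpace (Ξ t)]

lemma measurable_finInit :
    Measurable (fun (x : ∀ t, Ξ t) (t : Fin n) => x t.castSucc) :=
  measurable_pi_lambda _ fun _ => measurable_pi_apply _

lemma measurable_finSnoc :
    Measurable (fun z : (∀ t : Fin n, Ξ t.castSucc) × Ξ (Fin.last n) =>
      Fin.snoc (α := Ξ) z.1 z.2) := by
  refine measurable_pi_lambda _ fun t => ?_
  induction t using Fin.lastCases with
  | last => simpa only [Fin.snoc_last] using measurable_snd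
  | cast t =>
    simp only [Fin.snoc_castSucc]
    exact (measurable_pi_apply t).comp measurable_fst

instance initMarginal_isProbabilityMeasure (P : Measure (∀ t, Ξ t)) [IsProbabilityMeasure P] :
    IsProbabilityMeasure (initMarginal P) :=
  Measure.isProbabilityMeasure_map measurable_finInit.aemeasurable

lemma map_finSnoc_map_finInit_last (P : Measure (∀ t, Ξ t)) :
    (P.map fun x => ((fun t : Fin n => x t.castSucc), x (Fin.last n))).map
      (fun z => Fin.snoc (α := Ξ) z.1 z.2) = P := by
  rw [Measure.map_map measurable_finSnoc
    (measurable_finInit.prodMk (measurable_pi_apply (Fin.last n)))]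
  convert Measure.map_id
  funext x
  exact Fin.snoc_init_self x

variable {P : Measure (∀ t, Ξ t)} {Y : (∀ t, Ξ t) → ℝ}

lemma integrable_comp_finSnoc (hY : Integrable Y P) :
    Integrable (fun z : (∀ t : Fin n, Ξ t.castSucc) × Ξ (Fin.last n) =>
      Y (Fin.snoc (α := Ξ) z.1 z.2))
      (P.map fun x => ((fun t : Fin n => x t.castSucc), x (Fin.last n))) := by
  rw [← map_finSnoc_map_finInit_last P] at hY
  exact hY.comp_measurable measurable_finSnoc

variable [∀ t, StandardBorelSpace (Ξ t)] [∀ t, Nonempty (Ξ t)]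

instance lastKernel_isMarkovKernel [IsFiniteMeasure P] : IsMarkovKernel (lastKernel P) := by
  unfold lastKernel
  infer_instance

lemma ae_ae_lastKernel [IsFiniteMeasure P] {p : (∀ t, Ξ t) → Prop} (hp : ∀ᵐ x ∂P, p x) :
    ∀ᵐ x ∂initMarginal P, ∀ᵐ ξ ∂lastKernel P x, p (Fin.snoc (α := Ξ) x ξ) := by
  rw [← map_finSnoc_map_finInit_last P] at hp
  have h := ae_of_ae_map measurable_finSnoc.aemeasurable hp
  rw [← compProd_map_condDistrib (measurable_pi_apply (Fin.last n)).aemeasurable] at h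
  exact Measure.ae_ae_of_ae_compProd h

lemma ae_integrable_lastKernel [IsFiniteMeasure P] (hY : Integrable Y P) :
    ∀ᵐ x ∂initMarginal P, Integrable (fun ξ => Y (Fin.snoc (α := Ξ) x ξ)) (lastKernel P x) :=
  (integrable_comp_finSnoc hY).condDistrib_ae_map
    (measurable_pi_apply (Fin.last n)).aemeasurable

/-- Keeps integrability alive along the induction: the conditional mean of `|Y|`, times `1 / (1 -
α)`, dominates. -/
lemma integrable_AVaR_lastKernel [IsProbabilityMeasure P] {α : ℝ} (hα0 : 0 ≤ α) (hα : α < 1)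
    (hY : Integrable Y P) :
    Integrable (fun x => AVaR α (lastKernel P x) (fun ξ => Y (Fin.snoc (α := Ξ) x ξ)))
      (initMarginal P) := by
  have hY' := integrable_comp_finSnoc hY
  have hlast : AEMeasurable (fun x : ∀ t, Ξ t => x (Fin.last n)) P :=
    (measurable_pi_apply (Fin.last n)).aemeasurable
  have hint := ae_integrable_lastKernel hY
  have hmeas : AEMeasurable
      (fun x => AVaR α (lastKernel P x) (fun ξ => Y (Fin.snoc (α := Ξ) x ξ)))
      (initMarginal P) := by
    have hinf : AEMeasurable (fun x => ⨅ q : ℚ, ((q : ℝ) + 1 / (1 - α) *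
        ∫ ξ, max (Y (Fin.snoc (α := Ξ) x ξ) - q) 0 ∂lastKernel P x)) (initMarginal P) := by
      refine AEMeasurable.iInf fun q => ?_
      have hq := AEStronglyMeasurable.integral_condDistrib_map hlast
        ((hY'.aemeasurable.sub_const (q : ℝ)).max
          (aemeasurable_const (b := (0 : ℝ)))).aestronglyMeasurable
      exact (hq.aemeasurable.const_mul _).const_add _
    refine hinf.congr ?_
    filter_upwards [hint] with x hx using (AVaR_eq_iInf_rat hα0 hα hx).symm
  refine ((hY'.integral_norm_condDistrib_map hlast).const_mul (1 / (1 - α))).mono'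
    hmeas.aestronglyMeasurable ?_
  filter_upwards [hint] with x hx using abs_AVaR_le hα0 hα hx

end Disintegration

/-- Two random variables that are compatible with a cost function on sets of full measure have
nested Average Values-at-Risk whose distance is controlled by the nested cost. -/
theorem ofReal_abs_nestedAVaR_sub_le {r : ℝ} (hr : 1 ≤ r) {T : ℕ} {Ξ : Fin T → Type u}
    [∀ t, MeasurableSpace (Ξ t)] [∀ t, StandardBorelSpace (Ξ t)] [∀ t, Nonempty (Ξ t)]
    {P Q : Measure (∀ t, Ξ t)} [IsProbabilityMeasure P] [IsProbabilityMeasure Q]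
    {Y Z : (∀ t, Ξ t) → ℝ} (hY : Integrable Y P) (hZ : Integrable Z Q)
    {α : Fin T → ℝ} (hα : ∀ t, α t ∈ Set.Ico (0 : ℝ) 1) {K : ℝ}
    {c : (∀ t, Ξ t) → (∀ t, Ξ t) → ℝ≥0∞} {s t : Set (∀ t, Ξ t)} (hs : s ∈ ae P) (ht : t ∈ ae Q)
    (h : ∀ x ∈ s, ∀ y ∈ t, ENNReal.ofReal |Y x - Z y| ≤ ENNReal.ofReal K * c x y) :
    ENNReal.ofReal |nestedAVaR α P Y - nestedAVaR α Q Z|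
      ≤ ENNReal.ofReal (K / ∏ t, (1 - α t)) * nestedCost r c P Q := by
  induction T generalizing K with
  | zero =>
    -- A set of full measure for a probability is nonempty, so it contains the empty tuple.
    obtain ⟨x, hx⟩ := Filter.nonempty_of_mem hs
    obtain ⟨y, hy⟩ := Filter.nonempty_of_mem ht
    have hxy := h x hx y hy
    rw [Subsingleton.elim x fun t => t.elim0, Subsingleton.elim y fun t => t.elim0] at hxy
    simpa [nestedAVaR, nestedCost] using hxy
  | succ n ih =>
    have h0 := (hα (Fin.last n)).1
    have h1 := (hα (Fin.last n)).2
    -- Regroups the constant so that `K / (1 - α (Fin.last n))` plays the role of `K` for the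
    -- earlier stages.
    rw [nestedAVaR, nestedAVaR, nestedCost, Fin.prod_univ_castSucc,
      mul_comm (∏ t : Fin n, _), ← div_div]
    refine ih (integrable_AVaR_lastKernel h0 h1 hY) (integrable_AVaR_lastKernel h0 h1 hZ)
      (fun t => hα t.castSucc)
      (Filter.inter_mem (ae_integrable_lastKernel hY) (ae_ae_lastKernel hs))
      (Filter.inter_mem (ae_integrable_lastKernel hZ) (ae_ae_lastKernel ht)) ?_
    rintro x ⟨hYx, hsx⟩ y ⟨hZy, hty⟩
    exact ofReal_abs_AVaR_sub_le_wasserstein h0 h1 hr hYx hZy hsx hty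
      fun ξ hξ η hη => h _ hξ _ hη

theorem mainTheorem9 {T : ℕ} (Ξ : Fin T → Type u)
    [∀ t, TopologicalSpace (Ξ t)] [∀ t, PolishSpace (Ξ t)] [∀ t, Nonempty (Ξ t)]
    [∀ t, MeasurableSpace (Ξ t)] [∀ t, BorelSpace (Ξ t)]
    (m : MetricSpace (∀ t, Ξ t))
    (hm : m.toUniformSpace.toTopologicalSpace = Pi.topologicalSpace)
    (P Q : Measure (∀ t, Ξ t)) [IsProbabilityMeasure P] [IsProbabilityMeasure Q]
    (Y : (∀ t, Ξ t) → ℝ) (L : ℝ) (hL : 0 ≤ L)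
    (hY : ∀ x y, |Y x - Y y| ≤ L * m.dist x y)
    (hYP : Integrable Y P) (hYQ : Integrable Y Q)
    (α : Fin T → ℝ) (hα : ∀ t, α t ∈ Set.Icc (0 : ℝ) 1)
    (a : ℝ) (ha : 1 - ∏ t, (1 - α t) ≤ a) (ha1 : a < 1)
    (r : ℝ) (hr : 1 ≤ r) :
    ENNReal.ofReal |nestedAVaR α P Y - nestedAVaR α Q Y|
      ≤ ENNReal.ofReal (L / (1 - a)) * nestedDist r m.dist P Q := by
  -- The product is at least `1 - a > 0`, so no level equals `1` and the essential supremum never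
  -- occurs.
  have hprod : ∏ t, (1 - α t) ≠ 0 := by linarith
  have hα' : ∀ t, α t ∈ Set.Ico (0 : ℝ) 1 := fun t =>
    ⟨(hα t).1, (hα t).2.lt_of_ne fun ht =>
      Finset.prod_ne_zero_iff.1 hprod t (Finset.mem_univ t) (by rw [ht, sub_self])⟩
  refine (ofReal_abs_nestedAVaR_sub_le hr hYP hYQ hα' Filter.univ_mem Filter.univ_mem
    (K := L) (c := fun x y => ENNReal.ofReal (m.dist x y)) fun x _ y _ => ?_).trans ?_
  · rw [← ENNReal.ofReal_mul hL]
    exact ENNReal.ofReal_le_ofReal (hY x y)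
  · rw [nestedDist]
    gcongr ENNReal.ofReal ?_ * _
    exact div_le_div_of_nonneg_left hL (by linarith) (by linarith)
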